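/- Let $\ell\ge 1$ and let $\mathfrak g=\mathfrak{sp}(2\ell,\mathbb C)$ be the complex simple Lie algebra of type $C_\ell$, with diagonal Cartan subalgebra $\mathfrak h$, roots $\{\pm\epsilon_i\pm\epsilon_j\mid 1\le i\le j\le \ell\}\setminus\{0\}$, simple roots $\alpha_i=\epsilon_i-\epsilon_{i+1}$ ($1\le i<\ell$), $\alpha_\ell=2\epsilon_\ell$, maximal root $\theta=2\epsilon_1$, $\omega_0=0$, $\omega_r=\epsilon_1+\dots+\epsilon_r$ for $1\le r\le\ell$, and $\langle\cdot,\cdot\rangle$ the invariant symmetric bilinear form normalized by $\langle\theta,\theta\rangle=2$. For $1\le i\le j\le\ell$ let $x_{ij}$ be any nonzero root vector of $\mathfrak g$ for the root $\epsilon_i+\epsilon_j$. Let $\tilde{\mathfrak g}=\mathfrak g\otimes\mathbb C[t,t^{-1}]\oplus\mathbb C c\oplus\mathbb C d$ be the affine Lie algebra of type $C_\ell^{(1)}$: writing $x(n)=x\otimes t^n$, $$[x(m),y(n)]=[x,y](m+n)+m\langle x,y\rangle\delta_{m+n,0}\,c,\qquad [c,\tilde{\mathfrak g}]=0,\qquad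 [d,x(n)]=n\,x(n).$$ For $0\le r\le\ell$ let $\Lambda_r=\Lambda_0+\omega_r$ be the $r$-th fundamental weight, where $\Lambda_0(c)=1$, $\Lambda_0(\mathfrak h)=0$, $\Lambda_0(d)=0$, and $\omega_r(c)=\omega_r(d)=0$. Let $L(\Lambda_r)$ be a standard $\tilde{\mathfrak g}$-module with highest weight $\Lambda_r$, i.e. an integrable module generated by a highest weight vector $v_{\Lambda_r}\ne0$ of weight $\Lambda_r$: this vector is annihilated by $\mathfrak n_+\oplus\mathfrak g\otimes t\,\mathbb C[t]$, where $\mathfrak n_+$ is the sum of the root spaces of the positive roots, and $\mathfrak h\oplus\mathbb Cc\oplus\mathbb Cd$ acts on it by $\Lambda_r$. Then for all $1\le i\le j\le\ell$: $$x_{ij}(-1)v_{\Lambda_r}=0\quad\text{if } j\le r,\qquad\qquad x_{ij}(-1)v_{\Lambda_r}\neq0\quad\text{if } j>r.$$ -/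

import Mathlib

noncomputable section

namespace AffineC

open LieAlgebra TensorProduct

/-! ### The simple Lie algebra of type `C_ℓ` -/

/-- The complex simple Lie algebra of type `C_ℓ`, realized as `sp(2ℓ, ℂ)`: the block matrices
`(A, B; C, -Aᵀ)` with `B`, `C` symmetric. -/
abbrev G (ℓ : ℕ) : Type := LieAlgebra.Symplectic.sp (Fin ℓ) ℂ

section
attribute [local instance] LieRing.ofAssociativeRing

theorem mem_sp {ℓ : ℕ} (X : Matrix (Fin ℓ ⊕ Fin ℓ) (Fin ℓ ⊕ Fin ℓ) ℂ) :
    X ∈ LieAlgebra.Symplectic.sp (Fin ℓ) ℂ ↔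
      X.transpose * Matrix.J (Fin ℓ) ℂ = Matrix.J (Fin ℓ) ℂ * (-X) := by
  rw [LieAlgebra.Symplectic.sp, mem_skewAdjointMatricesLieSubalgebra,
    mem_skewAdjointMatricesSubmodule]
  rfl

theorem coe_lie {ℓ : ℕ} (x y : G ℓ) :
    ((⁅x, y⁆ : G ℓ) : Matrix (Fin ℓ ⊕ Fin ℓ) (Fin ℓ ⊕ Fin ℓ) ℂ) =
      x.1 * y.1 - y.1 * x.1 := rfl

/-- The Cartan subalgebra of diagonal matrices, parametrized by `ℂ^ℓ`:
`a ↦ diag(a₁, …, a_ℓ, -a₁, …, -a_ℓ)`, so that `ε_i` is the `i`-th coordinate. -/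
def cartan (ℓ : ℕ) : (Fin ℓ → ℂ) →ₗ[ℂ] G ℓ where
  toFun a := ⟨Matrix.diagonal (Sum.elim a (-a)), by
    rw [mem_sp, Matrix.diagonal_transpose]
    ext (i | i) (j | j) <;>
      simp [Matrix.diagonal_mul, Matrix.J, Matrix.one_apply,
        Matrix.mul_diagonal]
    all_goals grind⟩
  map_add' a b := by
    ext (i | i) (j | j) <;> simp [Matrix.diagonal_apply]
    all_goals grind
  map_smul' s a := by
    ext (i | i) (j | j) <;> simp [Matrix.diagonal_apply]

/-- The invariant symmetric bilinear form `⟨x, y⟩ = tr (x y)`. It is the multiple of the Killing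
form for which `⟨ε_i, ε_j⟩ = δ_{ij} / 2` on the dual of the Cartan subalgebra, i.e. for which the
maximal root `θ = 2 ε₁` satisfies `⟨θ, θ⟩ = 2`. -/
def form (ℓ : ℕ) : LinearMap.BilinForm ℂ (G ℓ) :=
  LinearMap.mk₂ ℂ (fun x y => Matrix.trace (x.1 * y.1))
    (by intro x y z; simp [add_mul]) (by intro s x y; simp)
    (by intro x y z; simp [mul_add]) (by intro s x y; simp)

@[simp] theorem form_apply {ℓ : ℕ} (x y : G ℓ) : form ℓ x y = Matrix.trace (x.1 * y.1) := rfl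

theorem form_isSymm (ℓ : ℕ) : (form ℓ).IsSymm :=
  ⟨fun x y => by simp [Matrix.trace_mul_comm x.1 y.1]⟩

theorem form_lieInvariant (ℓ : ℕ) : (form ℓ).lieInvariant (G ℓ) := by
  intro x y z
  simp only [form_apply, coe_lie, sub_mul, mul_sub, Matrix.trace_sub]
  rw [← mul_assoc, ← mul_assoc, Matrix.trace_mul_comm (x.1 * y.1), ← mul_assoc,
    Matrix.trace_mul_comm (z.1 * x.1), ← mul_assoc]
  ring

theorem form_cartan (ℓ : ℕ) (a b : Fin ℓ → ℂ) :
    form ℓ (cartan ℓ a) (cartan ℓ b) = 2 * ∑ i, a i * b i := by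
  simp [form_apply, cartan, Matrix.trace, two_mul]

/-! ### The affine Lie algebra of type `C_ℓ^{(1)}` -/

/-- The loop algebra `𝔤 ⊗ ℂ[t, t⁻¹]`. -/
abbrev Loop (ℓ : ℕ) : Type := loopAlgebra ℂ ℤ (G ℓ)

/-- `x ⊗ tⁿ` in the loop algebra. -/
def loopTerm {ℓ : ℕ} (n : ℤ) : G ℓ →ₗ[ℂ] Loop ℓ :=
  TensorProduct.mk ℂ _ _ (AddMonoidAlgebra.single n 1)

/-- The cocycle with `(x ⊗ tⁱ, y ⊗ tʲ) ↦ i ⟨x, y⟩ δ_{i+j,0}`. Mathlib's cocycle of a form `Φ` is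
`(x ⊗ tⁱ, y ⊗ tʲ) ↦ j Φ(x, y) δ_{i+j,0}`, whence the sign. -/
def cocycle (ℓ : ℕ) :
    LieModule.Cohomology.twoCocycle ℂ (Loop ℓ) (TrivialLieModule ℂ (Loop ℓ) ℂ) :=
  LoopAlgebra.twoCocycleOfBilinear ℂ ℤ (G ℓ) (-form ℓ)
    (fun x y z => by simp only [LinearMap.neg_apply]; rw [form_lieInvariant])
    ⟨fun x y => by simp only [LinearMap.neg_apply]; rw [(form_isSymm ℓ).eq]⟩

/-- `ĝ = 𝔤 ⊗ ℂ[t, t⁻¹] + ℂ c`. -/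
abbrev Hat (ℓ : ℕ) : Type := ofTwoCocycle (cocycle ℓ)

theorem cocycle_term {ℓ : ℕ} (i j : ℤ) (x y : G ℓ) :
    (cocycle ℓ : LieModule.Cohomology.twoCochain ℂ (Loop ℓ) (TrivialLieModule ℂ (Loop ℓ) ℂ))
        (loopTerm i x) (loopTerm j y) =
      (TrivialLieModule.equiv ℂ (Loop ℓ) ℂ).symm
        (if i + j = 0 then (i : ℂ) * form ℓ x y else 0) := by
  change (TrivialLieModule.equiv ℂ (Loop ℓ) ℂ).symm
    (LoopAlgebra.residuePairing ℂ ℤ (G ℓ) (-form ℓ) (loopTerm i x) (loopTerm j y)) = _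
  refine congrArg _ ?_
  simp only [loopTerm, TensorProduct.mk_apply, LoopAlgebra.residuePairing_apply_apply,
    LoopAlgebra.toFinsupp_single_tmul]
  rw [Finsupp.sum_single_index (by simp)]
  by_cases h : i + j = 0
  · obtain rfl : j = -i := by omega
    simp
  · have : i ≠ -j := by omega
    simp [h, Finsupp.single_eq_of_ne' this]

/-- The derivation `t d/dt` of the loop algebra: `x ⊗ tⁿ ↦ n (x ⊗ tⁿ)`. -/
def loopDeg (ℓ : ℕ) : Loop ℓ →ₗ[ℂ] Loop ℓ :=
  LinearMap.rTensor (G ℓ)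
    ((AddMonoidAlgebra.basis ℤ ℂ).constr ℂ fun n => AddMonoidAlgebra.single n (n : ℂ))

theorem loopDeg_term {ℓ : ℕ} (n : ℤ) (x : G ℓ) :
    loopDeg ℓ (loopTerm n x) = (n : ℂ) • loopTerm n x := by
  have h : (AddMonoidAlgebra.single n (1 : ℂ)) = AddMonoidAlgebra.basis ℤ ℂ n := by simp
  rw [loopTerm, TensorProduct.mk_apply, loopDeg, LinearMap.rTensor_tmul, h,
    Module.Basis.constr_basis, ← h, TensorProduct.smul_tmul', AddMonoidAlgebra.smul_single,
    smul_eq_mul, mul_one]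

theorem loopTerm_lie {ℓ : ℕ} (i j : ℤ) (x y : G ℓ) :
    ⁅loopTerm i x, loopTerm j y⁆ = loopTerm (i + j) ⁅x, y⁆ := by
  simp only [loopTerm, TensorProduct.mk_apply, LieAlgebra.ExtendScalars.bracket_tmul,
    AddMonoidAlgebra.single_mul_single, mul_one]

/-- Two linear maps out of the loop algebra agree if they agree on all `x ⊗ tⁿ`. -/
theorem loop_ext {ℓ : ℕ} {M : Type*} [AddCommMonoid M] [Module ℂ M] {f g : Loop ℓ →ₗ[ℂ] M}
    (h : ∀ n x, f (loopTerm n x) = g (loopTerm n x)) : f = g := by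
  apply TensorProduct.ext
  apply (AddMonoidAlgebra.basis ℤ ℂ).ext
  intro n
  ext x
  simpa [loopTerm] using h n x

theorem loopDeg_lie {ℓ : ℕ} (f g : Loop ℓ) :
    loopDeg ℓ ⁅f, g⁆ = ⁅f, loopDeg ℓ g⁆ + ⁅loopDeg ℓ f, g⁆ := by
  let B : Loop ℓ →ₗ[ℂ] Loop ℓ →ₗ[ℂ] Loop ℓ := (LieModule.toEnd ℂ (Loop ℓ) (Loop ℓ)).toLinearMap
  have hB : ∀ i j x y, B (loopTerm i x) (loopTerm j y) = loopTerm (i + j) ⁅x, y⁆ := loopTerm_lie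
  have key : B.compr₂ (loopDeg ℓ) = B.compl₂ (loopDeg ℓ) + B.comp (loopDeg ℓ) := by
    apply loop_ext
    intro i x
    apply loop_ext
    intro j y
    simp only [LinearMap.compr₂_apply, LinearMap.add_apply, LinearMap.compl₂_apply,
      LinearMap.comp_apply, loopDeg_term, map_smul, LinearMap.smul_apply, hB, ← add_smul]
    push_cast
    rw [add_comm]
  exact LinearMap.congr_fun₂ key f g

theorem cocycle_loopDeg {ℓ : ℕ} (f g : Loop ℓ) :
    (cocycle ℓ : LieModule.Cohomology.twoCochain ℂ (Loop ℓ) (TrivialLieModule ℂ (Loop ℓ) ℂ))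
        (loopDeg ℓ f) g +
      (cocycle ℓ : LieModule.Cohomology.twoCochain ℂ (Loop ℓ) (TrivialLieModule ℂ (Loop ℓ) ℂ))
        f (loopDeg ℓ g) = 0 := by
  let C : Loop ℓ →ₗ[ℂ] Loop ℓ →ₗ[ℂ] TrivialLieModule ℂ (Loop ℓ) ℂ := (cocycle ℓ).1.1
  have hC : ∀ i j x y, C (loopTerm i x) (loopTerm j y) =
      (TrivialLieModule.equiv ℂ (Loop ℓ) ℂ).symm
        (if i + j = 0 then (i : ℂ) * form ℓ x y else 0) := cocycle_term
  have key : C.comp (loopDeg ℓ) + C.compl₂ (loopDeg ℓ) = 0 := by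
    apply loop_ext
    intro i x
    apply loop_ext
    intro j y
    simp only [LinearMap.add_apply, LinearMap.compl₂_apply, LinearMap.comp_apply, loopDeg_term,
      map_smul, LinearMap.smul_apply, hC, LinearMap.zero_apply, ← add_smul]
    split_ifs with h
    · have : (i : ℂ) + j = 0 := by exact_mod_cast h
      rw [this, zero_smul]
    · simp
  exact LinearMap.congr_fun₂ key f g

/-- The derivation of `ĝ` extending `t d/dt` and killing `c`. -/
def hatDeg (ℓ : ℕ) : LieDerivation ℂ (Hat ℓ) (Hat ℓ) where
  toFun f := ofProd (cocycle ℓ) (loopDeg ℓ ((ofProd (cocycle ℓ)).symm f).1, 0)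
  map_add' f g := by simp [← of_add]
  map_smul' s f := by simp [← of_smul]
  leibniz' f g := by
    obtain ⟨⟨f, a⟩⟩ := f
    obtain ⟨⟨g, b⟩⟩ := g
    have h := cocycle_loopDeg f g
    have h' := LieModule.Cohomology.twoCochain_skew (cocycle ℓ).1 g (loopDeg ℓ f)
    change ofProd (cocycle ℓ) (loopDeg ℓ ⁅f, g⁆, 0) =
      ofProd (cocycle ℓ) (⁅f, loopDeg ℓ g⁆, (cocycle ℓ).1 f (loopDeg ℓ g) + 0 - 0) -
      ofProd (cocycle ℓ) (⁅g, loopDeg ℓ f⁆, (cocycle ℓ).1 g (loopDeg ℓ f) + 0 - 0)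
    rw [sub_eq_add_neg]
    change _ = ofProd (cocycle ℓ) (_ + -_, _ + -_)
    rw [loopDeg_lie, ← lie_skew (loopDeg ℓ f) g]
    refine congrArg _ (Prod.ext rfl ?_)
    change 0 = ((cocycle ℓ).1 f (loopDeg ℓ g) + 0 - 0) + -((cocycle ℓ).1 g (loopDeg ℓ f) + 0 - 0)
    rw [add_zero, sub_zero, add_zero, sub_zero, h', add_comm]
    exact h.symm

/-- The Lie algebra homomorphism `ℂ → Der ĝ`, `s ↦ s t d/dt`. -/
def degHom (ℓ : ℕ) : ℂ →ₗ⁅ℂ⁆ LieDerivation ℂ (Hat ℓ) (Hat ℓ) where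
  toLinearMap := LinearMap.toSpanSingleton ℂ _ (hatDeg ℓ)
  map_lie' {s t} := by
    simp [LinearMap.toSpanSingleton_apply, Ring.lie_def, mul_comm]

/-- The affine Lie algebra of type `C_ℓ^{(1)}`: `ĝ + ℂ d`. -/
def Affine (ℓ : ℕ) : Type := SemiDirectSum (Hat ℓ) ℂ (degHom ℓ)

instance (ℓ : ℕ) : LieRing (Affine ℓ) :=
  inferInstanceAs (LieRing (SemiDirectSum (Hat ℓ) ℂ (degHom ℓ)))

instance (ℓ : ℕ) : LieAlgebra ℂ (Affine ℓ) :=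
  inferInstanceAs (LieAlgebra ℂ (SemiDirectSum (Hat ℓ) ℂ (degHom ℓ)))

/-- The element `x(n) = x ⊗ tⁿ` of the affine Lie algebra. -/
def mode {ℓ : ℕ} (n : ℤ) : G ℓ →ₗ[ℂ] Affine ℓ where
  toFun x := (⟨ofProd (cocycle ℓ) (loopTerm n x, 0), 0⟩ : SemiDirectSum (Hat ℓ) ℂ (degHom ℓ))
  map_add' x y := by
    refine SemiDirectSum.ext ?_ (add_zero _).symm
    change _ = ofProd _ _ + ofProd _ _
    rw [← of_add]
    simp
  map_smul' s x := by
    refine SemiDirectSum.ext ?_ (mul_zero _).symm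
    change _ = s • ofProd _ _
    rw [← of_smul]
    simp

/-- The canonical central element `c`. -/
def central (ℓ : ℕ) : Affine ℓ :=
  (⟨ofProd (cocycle ℓ) (0, (TrivialLieModule.equiv ℂ (Loop ℓ) ℂ).symm 1), 0⟩ :
    SemiDirectSum (Hat ℓ) ℂ (degHom ℓ))

/-- The degree element `d`. -/
def degree (ℓ : ℕ) : Affine ℓ := (⟨0, 1⟩ : SemiDirectSum (Hat ℓ) ℂ (degHom ℓ))

theorem mode_lie_mode {ℓ : ℕ} (i j : ℤ) (x y : G ℓ) :
    ⁅mode i x, mode j y⁆ =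
      mode (i + j) ⁅x, y⁆ + (if i + j = 0 then (i : ℂ) * form ℓ x y else 0) • central ℓ := by
  refine SemiDirectSum.ext ?_ ?_
  · change ofProd (cocycle ℓ) (⁅loopTerm i x, loopTerm j y⁆,
        (cocycle ℓ).1 (loopTerm i x) (loopTerm j y) + 0 - 0) +
        (0 : ℂ) • hatDeg ℓ (ofProd (cocycle ℓ) (loopTerm j y, 0)) -
        (0 : ℂ) • hatDeg ℓ (ofProd (cocycle ℓ) (loopTerm i x, 0)) =
      ofProd (cocycle ℓ) (loopTerm (i + j) ⁅x, y⁆, 0) +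
        (if i + j = 0 then (i : ℂ) * form ℓ x y else 0) •
          ofProd (cocycle ℓ) (0, (TrivialLieModule.equiv ℂ (Loop ℓ) ℂ).symm 1)
    rw [zero_smul, zero_smul, add_zero, sub_zero, ← of_smul, ← of_add, loopTerm_lie,
      add_zero, sub_zero]
    rw [Prod.smul_mk, smul_zero, Prod.mk_add_mk, add_zero, zero_add, ← map_smul, smul_eq_mul,
      mul_one]
    exact congrArg _ (Prod.ext rfl (cocycle_term i j x y))
  · change (⁅(0 : ℂ), (0 : ℂ)⁆ : ℂ) = 0 + (if i + j = 0 then (i : ℂ) * form ℓ x y else 0) • 0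
    simp

theorem central_lie {ℓ : ℕ} (u : Affine ℓ) : ⁅central ℓ, u⁆ = 0 := by
  obtain ⟨⟨⟨f, a⟩⟩, s⟩ := u
  refine SemiDirectSum.ext ?_ ?_
  · change ofProd (cocycle ℓ) (⁅(0 : Loop ℓ), f⁆, (cocycle ℓ).1 0 f + 0 - 0) +
        (0 : ℂ) • hatDeg ℓ (ofProd (cocycle ℓ) (f, a)) -
        s • ofProd (cocycle ℓ) (loopDeg ℓ 0, 0) = 0
    have h : ((⁅(0 : Loop ℓ), f⁆ : Loop ℓ), (cocycle ℓ).1 0 f + 0 - 0) = 0 :=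
      Prod.ext (zero_lie f) (by simp)
    rw [zero_smul, map_zero (loopDeg ℓ), h, of_zero, zero_add, ← of_smul, Prod.smul_mk, smul_zero,
      smul_zero]
    exact sub_self _
  · change (⁅(0 : ℂ), s⁆ : ℂ) = 0
    simp

theorem degree_lie_mode {ℓ : ℕ} (j : ℤ) (x : G ℓ) :
    ⁅degree ℓ, mode j x⁆ = (j : ℂ) • mode j x := by
  refine SemiDirectSum.ext ?_ ?_
  · change ⁅(0 : Hat ℓ), ofProd (cocycle ℓ) (loopTerm j x, 0)⁆ +
        (1 : ℂ) • ofProd (cocycle ℓ) (loopDeg ℓ (loopTerm j x), 0) -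
        (0 : ℂ) • hatDeg ℓ 0 = (j : ℂ) • ofProd (cocycle ℓ) (loopTerm j x, 0)
    rw [zero_lie, zero_smul, one_smul, zero_add, sub_zero, ← of_smul, loopDeg_term]
    simp
  · change (⁅(1 : ℂ), (0 : ℂ)⁆ : ℂ) = (j : ℂ) • 0
    simp

end

/-! ### Roots and triangular decomposition -/

/-- `ε_k`, `1 ≤ k ≤ ℓ`, as a coordinate vector. -/
def eps (ℓ k : ℕ) : Fin ℓ → ℤ := fun m => if m.val + 1 = k then 1 else 0

/-- The root space of `α = ∑ α_k ε_k`. -/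
def rootSpace {ℓ : ℕ} (α : Fin ℓ → ℤ) : Submodule ℂ (G ℓ) where
  carrier := {x | ∀ a : Fin ℓ → ℂ, ⁅cartan ℓ a, x⁆ = (∑ m, (α m : ℂ) * a m) • x}
  add_mem' hx hy a := by rw [lie_add, hx a, hy a, smul_add]
  zero_mem' a := by simp
  smul_mem' s x hx a := by rw [LieAlgebra.lie_smul, hx a, smul_comm]

/-- The positive roots `ε_i + ε_j` (`i ≤ j`) and `ε_i - ε_j` (`i < j`). -/
def IsPositiveRoot {ℓ : ℕ} (α : Fin ℓ → ℤ) : Prop :=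
  ∃ i j : ℕ, 1 ≤ i ∧ j ≤ ℓ ∧
    ((i ≤ j ∧ α = eps ℓ i + eps ℓ j) ∨ (i < j ∧ α = eps ℓ i - eps ℓ j))

/-- The simple roots `α_k = ε_k - ε_{k+1}` for `k < ℓ`, and `α_ℓ = 2 ε_ℓ`. -/
def simpleRoot (ℓ k : ℕ) : Fin ℓ → ℤ :=
  if k < ℓ then eps ℓ k - eps ℓ (k + 1) else 2 • eps ℓ k

/-- The maximal root `θ = 2 ε₁`. -/
def maximalRoot (ℓ : ℕ) : Fin ℓ → ℤ := 2 • eps ℓ 1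

/-- `𝔫₊ + 𝔤 ⊗ t ℂ[t]`. -/
def nPlus (ℓ : ℕ) : Submodule ℂ (Affine ℓ) :=
  (⨆ (α : Fin ℓ → ℤ) (_ : IsPositiveRoot α), (rootSpace α).map (mode 0)) ⊔
    ⨆ (n : ℤ) (_ : 0 < n), LinearMap.range (mode (ℓ := ℓ) n)

/-- The Cartan subalgebra `𝔥 + ℂ c + ℂ d` of the affine Lie algebra, parametrized by triples
`(a, s, t)`, `a ∈ ℂ^ℓ`. -/
def affineCartan (ℓ : ℕ) : ((Fin ℓ → ℂ) × ℂ × ℂ) →ₗ[ℂ] Affine ℓ :=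
  ((mode 0).comp (cartan ℓ)).coprod
    ((LinearMap.toSpanSingleton ℂ _ (central ℓ)).coprod
      (LinearMap.toSpanSingleton ℂ _ (degree ℓ)))

theorem affineCartan_apply {ℓ : ℕ} (a : Fin ℓ → ℂ) (s t : ℂ) :
    affineCartan ℓ (a, s, t) = mode 0 (cartan ℓ a) + (s • central ℓ + t • degree ℓ) := by
  simp [affineCartan]

/-- Weights: linear functionals on the Cartan subalgebra of the affine Lie algebra. -/
abbrev Weight (ℓ : ℕ) : Type := Module.Dual ℂ ((Fin ℓ → ℂ) × ℂ × ℂ)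

/-- `Λ₀`, with `Λ₀(c) = 1` and `Λ₀(𝔥) = Λ₀(d) = 0`. -/
def weightZero (ℓ : ℕ) : Weight ℓ := LinearMap.fst ℂ ℂ ℂ ∘ₗ LinearMap.snd ℂ _ _

/-- `ω_r = ε₁ + ⋯ + ε_r` (so `ω₀ = 0`), extended by zero to `c` and `d`. -/
def omega (ℓ r : ℕ) : Weight ℓ :=
  (∑ m : Fin ℓ, if m.val + 1 ≤ r then LinearMap.proj m else 0) ∘ₗ LinearMap.fst ℂ _ _

/-- The fundamental weights `Λ_r = Λ₀ + ω_r`, `0 ≤ r ≤ ℓ`. -/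
def fundamentalWeight (ℓ r : ℕ) : Weight ℓ := weightZero ℓ + omega ℓ r

theorem fundamentalWeight_apply {ℓ : ℕ} (r : ℕ) (a : Fin ℓ → ℂ) (s t : ℂ) :
    fundamentalWeight ℓ r (a, s, t) = s + ∑ m : Fin ℓ, if m.val + 1 ≤ r then a m else 0 := by
  simp only [fundamentalWeight, weightZero, omega, LinearMap.add_apply, LinearMap.comp_apply,
    LinearMap.fst_apply, LinearMap.snd_apply, LinearMap.sum_apply]
  congr 1
  refine Finset.sum_congr rfl fun m _ => ?_
  split_ifs <;> simp

/-! ### Standard modules -/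

/-- The root vectors of the affine Lie algebra for the real roots `±α₀, ±α₁, …, ±α_ℓ`, where
`α₀ = δ - θ`: the elements `x(0)` with `x ∈ 𝔤_{±α_k}`, `x(1)` with `x ∈ 𝔤_{-θ}`, and `x(-1)` with
`x ∈ 𝔤_θ`. These are the multiples of the Chevalley generators. -/
def IsSimpleRootVector {ℓ : ℕ} (u : Affine ℓ) : Prop :=
  (∃ k, 1 ≤ k ∧ k ≤ ℓ ∧ ∃ x : G ℓ,
      (x ∈ rootSpace (simpleRoot ℓ k) ∨ x ∈ rootSpace (-simpleRoot ℓ k)) ∧ u = mode 0 x) ∨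
    (∃ x ∈ rootSpace (-maximalRoot ℓ), u = mode 1 x) ∨
    (∃ x ∈ rootSpace (maximalRoot ℓ), u = mode (-1) x)

/-- `V` is a standard module, i.e. an integrable highest weight module, with highest weight `Λ`
and highest weight vector `v`. -/
structure IsStandardModule {ℓ : ℕ} {V : Type*} [AddCommGroup V] [Module ℂ V]
    [LieRingModule (Affine ℓ) V] [LieModule ℂ (Affine ℓ) V] (Λ : Weight ℓ) (v : V) : Prop where
  ne_zero : v ≠ 0
  nPlus_lie : ∀ u ∈ nPlus ℓ, ⁅u, v⁆ = 0
  cartan_lie : ∀ h, ⁅affineCartan ℓ h, v⁆ = Λ h • v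
  generates : LieSubmodule.lieSpan ℂ (Affine ℓ) {v} = ⊤
  integrable : ∀ u : Affine ℓ, IsSimpleRootVector u →
    ∀ w : V, ∃ N : ℕ, (LieModule.toEnd ℂ (Affine ℓ) V u ^ N) w = 0

end AffineC

end

namespace AffineC

open Matrix

/-! Root spaces for `ε_i + ε_j` are one-dimensional, so explicit matrices suffice.

Nonvanishing: for `y` of root `-ε_i - ε_j`, `y(1)` kills the highest weight vector `v`, so `y(1)
x(-1) v = [y(1), x(-1)] v`. The commutator lies in the affine Cartan subalgebra and acts by a
nonzero multiple of `2 - [i ≤ r] - [j ≤ r]`, where the `2` is the contribution of `c`. This is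
positive as soon as `j > r` (`mode_posRoot_lie_ne_zero`).

Vanishing: if `r ≥ 1`, the coroots of `α₀` and of `α_1, …, α_{r-1}` take the value `0` on `Λ_r`, so
by `sl₂`-theory and integrability the corresponding lowering operators kill `v`
(`lie_eq_zero_of_sl2`). For `α₀` this operator is `x_{11}(-1)`. Commuting it with the lowering
operators for `α_1, …, α_{r-1}` raises either index one step at a time and reaches every
`x_{ij}(-1)` with `i, j ≤ r`. -/

/-- The root vector `(0, E_ab + E_ba; 0, 0)` for the root `ε_a + ε_b`. -/
def posRoot {ℓ : ℕ} (a b : Fin ℓ) : G ℓ :=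
  ⟨fromBlocks 0 (single a b 1 + single b a 1) 0 0, by
    rw [mem_sp]
    simp [Matrix.J, fromBlocks_transpose, fromBlocks_multiply, fromBlocks_neg, add_comm]⟩

/-- The root vector `(0, 0; E_ab + E_ba, 0)` for the root `-ε_a - ε_b`. -/
def negRoot {ℓ : ℕ} (a b : Fin ℓ) : G ℓ :=
  ⟨fromBlocks 0 0 (single a b 1 + single b a 1) 0, by
    rw [mem_sp]
    simp [Matrix.J, fromBlocks_transpose, fromBlocks_multiply, fromBlocks_neg, add_comm]⟩

/-- The element `(E_ab, 0; 0, -E_ba)`, a root vector for the root `ε_a - ε_b` if `a ≠ b`. -/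
def glRoot {ℓ : ℕ} (a b : Fin ℓ) : G ℓ :=
  ⟨fromBlocks (single a b 1) 0 0 (-single b a 1), by
    rw [mem_sp]
    simp [Matrix.J, fromBlocks_transpose, fromBlocks_multiply, fromBlocks_neg]⟩

theorem cartan_coe {ℓ : ℕ} (a : Fin ℓ → ℂ) :
    (cartan ℓ a).1 = fromBlocks (diagonal a) 0 0 (-diagonal a) := by
  rw [show -diagonal a = diagonal (-a) by simp, fromBlocks_diagonal]
  rfl

theorem posRoot_comm {ℓ : ℕ} (a b : Fin ℓ) : posRoot a b = posRoot b a :=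
  Subtype.ext (by simp only [posRoot, add_comm])

/-! ### Weights of the explicit root vectors -/

theorem sum_eps_mul {ℓ : ℕ} (p : Fin ℓ) (a : Fin ℓ → ℂ) :
    ∑ m, (eps ℓ (p + 1) m : ℂ) * a m = a p := by
  simp [eps, Fin.val_inj]

theorem sum_eps_add_eps_mul {ℓ : ℕ} (p q : Fin ℓ) (a : Fin ℓ → ℂ) :
    ∑ m, (((eps ℓ (p + 1) + eps ℓ (q + 1)) m : ℤ) : ℂ) * a m = a p + a q := by
  simp [add_mul, Finset.sum_add_distrib, sum_eps_mul]

theorem cartan_lie_posRoot {ℓ : ℕ} (p q : Fin ℓ) (a : Fin ℓ → ℂ) :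
    ⁅cartan ℓ a, posRoot p q⁆ = (a p + a q) • posRoot p q := by
  apply Subtype.ext
  rw [coe_lie]
  change _ = _ • (posRoot p q).1
  ext (m | m) (n | n) <;>
    simp [cartan, posRoot, diagonal_mul, mul_diagonal, single_apply] <;> grind

theorem cartan_lie_negRoot {ℓ : ℕ} (p q : Fin ℓ) (a : Fin ℓ → ℂ) :
    ⁅cartan ℓ a, negRoot p q⁆ = (-(a p + a q)) • negRoot p q := by
  apply Subtype.ext
  rw [coe_lie]
  change _ = _ • (negRoot p q).1
  ext (m | m) (n | n) <;>
    simp [cartan, negRoot, diagonal_mul, mul_diagonal, single_apply] <;> grind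

theorem cartan_lie_glRoot {ℓ : ℕ} (p q : Fin ℓ) (a : Fin ℓ → ℂ) :
    ⁅cartan ℓ a, glRoot p q⁆ = (a p - a q) • glRoot p q := by
  apply Subtype.ext
  rw [coe_lie]
  change _ = _ • (glRoot p q).1
  ext (m | m) (n | n) <;>
    simp [cartan, glRoot, diagonal_mul, mul_diagonal, single_apply] <;> grind

theorem posRoot_mem_rootSpace {ℓ : ℕ} (p q : Fin ℓ) :
    posRoot p q ∈ rootSpace (eps ℓ (p + 1) + eps ℓ (q + 1)) := fun a => by
  rw [cartan_lie_posRoot, sum_eps_add_eps_mul]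

theorem glRoot_mem_rootSpace {ℓ : ℕ} (p q : Fin ℓ) :
    glRoot p q ∈ rootSpace (eps ℓ (p + 1) - eps ℓ (q + 1)) := fun a => by
  rw [cartan_lie_glRoot]
  simp [sub_mul, Finset.sum_sub_distrib, sum_eps_mul]

/-! ### Brackets and form values -/

/-- The operator that replaces the index `p` by `q`. The factor `2` appears because `posRoot p p`
has the entry `2 E_pp`. -/
theorem glRoot_lie_posRoot {ℓ : ℕ} (p q s : Fin ℓ) :
    ⁅glRoot q p, posRoot p s⁆ = (if p = s then 2 else 1 : ℂ) • posRoot q s := by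
  apply Subtype.ext
  rw [coe_lie]
  split_ifs with h
  · subst h
    simp [glRoot, posRoot, fromBlocks_multiply, sub_eq_add_neg, fromBlocks_neg,
      fromBlocks_add, mul_add, add_mul, two_smul]
    abel
  · have := Ne.symm h
    simp [glRoot, posRoot, fromBlocks_multiply, sub_eq_add_neg, fromBlocks_neg,
      fromBlocks_add, mul_add, add_mul, h, this]

theorem glRoot_lie_glRoot {ℓ : ℕ} (p q : Fin ℓ) :
    ⁅glRoot p q, glRoot q p⁆ = cartan ℓ (Pi.single p 1 - Pi.single q 1) := by
  apply Subtype.ext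
  rw [coe_lie, cartan_coe]
  simp [glRoot, fromBlocks_multiply, sub_eq_add_neg, fromBlocks_neg, fromBlocks_add,
    -fromBlocks_diagonal]
  constructor <;> ext m n <;> simp only [Matrix.add_apply, Matrix.neg_apply, single_apply,
    diagonal_apply, Pi.add_apply, Pi.neg_apply, Pi.single_apply] <;> grind

theorem negRoot_lie_posRoot {ℓ : ℕ} (p q : Fin ℓ) :
    ⁅negRoot p q, posRoot p q⁆ =
      (if p = q then 2 else 1 : ℂ) • cartan ℓ (-(Pi.single p 1 + Pi.single q 1)) := by
  apply Subtype.ext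
  rw [coe_lie]
  split_ifs with h
  · subst h
    simp [negRoot, posRoot, cartan_coe, fromBlocks_multiply, sub_eq_add_neg,
      fromBlocks_neg, fromBlocks_add, mul_add, add_mul, -fromBlocks_diagonal, two_smul]
    constructor <;> ext m n <;> simp only [Matrix.add_apply, Matrix.neg_apply, single_apply,
      diagonal_apply, Pi.single_apply] <;> grind
  · have := Ne.symm h
    simp [negRoot, posRoot, cartan_coe, fromBlocks_multiply, sub_eq_add_neg,
      fromBlocks_neg, fromBlocks_add, mul_add, add_mul, -fromBlocks_diagonal, h, this]
    constructor <;> ext m n <;> simp only [Matrix.add_apply, Matrix.neg_apply, single_apply,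
      diagonal_apply, Pi.single_apply] <;> grind

theorem form_negRoot_posRoot {ℓ : ℕ} (p q : Fin ℓ) :
    form ℓ (negRoot p q) (posRoot p q) = (if p = q then 2 else 1 : ℂ) * 2 := by
  rw [form_apply]
  split_ifs with h
  · subst h
    simp [negRoot, posRoot, fromBlocks_multiply, mul_add, add_mul, trace, single_apply,
      Finset.sum_add_distrib]
    norm_num
  · have := Ne.symm h
    simp [negRoot, posRoot, fromBlocks_multiply, mul_add, add_mul, trace, single_apply,
      Finset.sum_add_distrib, h, this]
    norm_num

/-- Each matrix entry is an eigenvector of the diagonal Cartan subalgebra, so an entry survives only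
if its weight is `ε_p + ε_q`; symmetry of the upper right block ties the two surviving entries
together. -/
theorem exists_eq_smul_posRoot {ℓ : ℕ} {p q : Fin ℓ} {x : G ℓ}
    (hx : x ∈ rootSpace (eps ℓ (p + 1) + eps ℓ (q + 1))) :
    ∃ s : ℂ, x = s • posRoot p q := by
  have key (a : Fin ℓ → ℂ) (m n : Fin ℓ ⊕ Fin ℓ) :
      Sum.elim a (-a) m * x.1 m n - x.1 m n * Sum.elim a (-a) n = (a p + a q) * x.1 m n := by
    have h := congrArg (fun y : G ℓ => y.1 m n) (hx a)
    rw [sum_eps_add_eps_mul] at h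
    simp only [coe_lie] at h
    simpa [cartan, diagonal_mul, mul_diagonal] using h
  have hsymm (m n : Fin ℓ) : x.1 (.inl m) (.inr n) = x.1 (.inl n) (.inr m) := by
    have h := congrFun₂ ((mem_sp _).1 x.2) (.inr m) (.inr n)
    simpa [Matrix.J, mul_apply, Fintype.sum_sum_type, one_apply] using h.symm
  have hz (m n : Fin ℓ) (h : ¬ (m = p ∧ n = q)) (h' : ¬ (m = q ∧ n = p)) :
      x.1 (.inl m) (.inr n) = 0 := by
    -- The coordinates `m` and `n` alone separate `ε_m + ε_n` from `ε_p + ε_q` when the unordered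
    -- pairs differ.
    have h1 := key (Pi.single m 1) (.inl m) (.inr n)
    have h2 := key (Pi.single n 1) (.inl m) (.inr n)
    simp only [Sum.elim_inl, Sum.elim_inr, Pi.neg_apply, Pi.single_apply] at h1 h2
    grind
  -- For `a = (1, …, 1)` the diagonal blocks have eigenvalue `0` and the lower left block `-2`,
  -- whereas `x` has eigenvalue `2`.
  have hl (m n : Fin ℓ) : x.1 (.inl m) (.inl n) = 0 := by
    simpa using key 1 (.inl m) (.inl n)
  have hr (m n : Fin ℓ) : x.1 (.inr m) (.inr n) = 0 := by
    simpa using key 1 (.inr m) (.inr n)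
  have hlr (m n : Fin ℓ) : x.1 (.inr m) (.inl n) = 0 := by
    have := key 1 (.inr m) (.inl n)
    simp only [Sum.elim_inl, Sum.elim_inr, Pi.neg_apply, Pi.one_apply] at this
    linear_combination -this / 4
  refine ⟨x.1 (.inl p) (.inr q) / (if p = q then 2 else 1), ?_⟩
  apply Subtype.ext
  change x.1 = _ • fromBlocks 0 (single p q 1 + single q p 1) 0 0
  ext (m | m) (n | n)
  · simp [hl]
  · have h1 := hsymm p q
    have h2 := hz m n
    simp only [Matrix.smul_apply, fromBlocks_apply₁₂, Matrix.add_apply, single_apply, smul_eq_mul]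
    grind
  · simp [hlr]
  · simp [hr]

/-! ### Action on the highest weight vector -/

section Module

variable {ℓ : ℕ} {V : Type*} [AddCommGroup V] [Module ℂ V] [LieRingModule (Affine ℓ) V]
  [LieModule ℂ (Affine ℓ) V] {Λ : Weight ℓ} {v : V}

/-- Were `f m` nonzero, it would be a primitive vector of weight `-2`. Then `e f^(n+1)` acts on it
as `-(n+1)(n+2) f^n`, a nonzero multiple, so no power of `f` could kill it. -/
theorem lie_eq_zero_of_sl2 {L M : Type*} [LieRing L] [LieAlgebra ℂ L] [AddCommGroup M]
    [Module ℂ M] [LieRingModule L M] [LieModule ℂ L M] {h e f : L} (hef : ⁅e, f⁆ = h)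
    (hhe : ⁅h, e⁆ = (2 : ℂ) • e) (hhf : ⁅h, f⁆ = -((2 : ℂ) • f)) {m : M} (he : ⁅e, m⁆ = 0)
    (hh : ⁅h, m⁆ = 0) {N : ℕ} (hN : (LieModule.toEnd ℂ L M f ^ N) m = 0) : ⁅f, m⁆ = 0 := by
  by_contra hne
  have h0 : h ≠ 0 := by
    rintro rfl
    apply hne
    have : f = 0 := by simpa using hhf
    simp [this]
  have t : IsSl2Triple h e f := ⟨h0, hef, by rw [hhe, two_smul, two_smul],
    by rw [hhf, two_smul, two_smul]⟩
  have P : t.HasPrimitiveVectorWith ⁅f, m⁆ (-2 : ℂ) :=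
    ⟨hne, by rw [leibniz_lie, hhf, hh]; simp, by rw [leibniz_lie, hef, hh, he]; simp⟩
  have hpow (n : ℕ) : (LieModule.toEnd ℂ L M f ^ n) ⁅f, m⁆ ≠ 0 := by
    induction n with
    | zero => simpa using hne
    | succ n ih =>
      intro h
      have := P.lie_e_pow_succ_toEnd_f n
      rw [h, lie_zero] at this
      rcases smul_eq_zero.1 this.symm with h | h
      · have h' : ((n + 1 : ℕ) : ℂ) * ((n + 2 : ℕ) : ℂ) = 0 := by
          push_cast; linear_combination -h
        norm_cast at h'
      · exact ih h
  apply hpow N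
  have : (LieModule.toEnd ℂ L M f ^ N) ⁅f, m⁆ = (LieModule.toEnd ℂ L M f ^ (N + 1)) m := by
    rw [pow_succ]; rfl
  rw [this, pow_succ', Module.End.mul_apply, hN, map_zero]

theorem IsStandardModule.mode_pos_lie (hv : IsStandardModule Λ v) {n : ℤ} (hn : 0 < n) (x : G ℓ) :
    ⁅mode n x, v⁆ = 0 :=
  hv.nPlus_lie _ <| Submodule.mem_sup_right <| Submodule.mem_iSup_of_mem n <|
    Submodule.mem_iSup_of_mem hn ⟨x, rfl⟩

theorem IsStandardModule.mode_zero_lie (hv : IsStandardModule Λ v) {α : Fin ℓ → ℤ}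
    (hα : IsPositiveRoot α) {x : G ℓ} (hx : x ∈ rootSpace α) : ⁅mode 0 x, v⁆ = 0 :=
  hv.nPlus_lie _ <| Submodule.mem_sup_left <| Submodule.mem_iSup_of_mem α <|
    Submodule.mem_iSup_of_mem hα ⟨x, hx, rfl⟩

theorem IsStandardModule.cartan_add_central_lie {r : ℕ}
    (hv : IsStandardModule (fundamentalWeight ℓ r) v) (a : Fin ℓ → ℂ) (s : ℂ) :
    ⁅mode 0 (cartan ℓ a) + s • central ℓ, v⁆ =
      (s + ∑ m : Fin ℓ, if m.val + 1 ≤ r then a m else 0) • v := by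
  have h := hv.cartan_lie (a, s, 0)
  rwa [affineCartan_apply, zero_smul, add_zero, fundamentalWeight_apply] at h

theorem sum_ite_single (r : ℕ) (p : Fin ℓ) :
    (∑ m : Fin ℓ, if m.val + 1 ≤ r then (Pi.single p 1 : Fin ℓ → ℂ) m else 0) =
      if p.val + 1 ≤ r then 1 else 0 := by
  rw [Finset.sum_eq_single p] <;> simp +contextual

theorem mode_negRoot_lie_posRoot (p q : Fin ℓ) :
    ⁅mode 1 (negRoot p q), mode (-1) (posRoot p q)⁆ = (if p = q then 2 else 1 : ℂ) •
      (mode 0 (cartan ℓ (-(Pi.single p 1 + Pi.single q 1))) + (2 : ℂ) • central ℓ) := by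
  rw [mode_lie_mode, negRoot_lie_posRoot, form_negRoot_posRoot, map_smul,
    smul_add, smul_smul]
  norm_num

theorem mode_negRoot_lie_posRoot_lie {r : ℕ}
    (hv : IsStandardModule (fundamentalWeight ℓ r) v) (p q : Fin ℓ) :
    ⁅mode 1 (negRoot p q), ⁅mode (-1) (posRoot p q), v⁆⁆ = ((if p = q then 2 else 1 : ℂ) *
      (2 - ((if p.val + 1 ≤ r then 1 else 0) + (if q.val + 1 ≤ r then 1 else 0)))) • v := by
  rw [leibniz_lie, hv.mode_pos_lie one_pos, lie_zero, add_zero, mode_negRoot_lie_posRoot,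
    smul_lie, hv.cartan_add_central_lie, smul_smul, ← sum_ite_single, ← sum_ite_single,
    ← Finset.sum_add_distrib, sub_eq_add_neg, ← Finset.sum_neg_distrib]
  congr 4
  ext m
  split_ifs <;> simp

theorem mode_posRoot_lie_ne_zero {r : ℕ} (hv : IsStandardModule (fundamentalWeight ℓ r) v)
    {p q : Fin ℓ} (hq : r < q.val + 1) : ⁅mode (-1) (posRoot p q), v⁆ ≠ 0 := by
  intro h
  have h' := mode_negRoot_lie_posRoot_lie hv p q
  -- With the index `q` beyond `r`, the scalar is at least `2 - 1`, times the factor `1` or `2`.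
  rw [h, lie_zero, eq_comm, if_neg hq.not_ge] at h'
  refine (smul_ne_zero ?_ hv.ne_zero) h'
  split_ifs <;> norm_num

/-- The simple coroot involved takes the value `1 - 1 = 0` on `Λ_r`, since both indices are at most
`r`. Consecutive indices are needed because integrability is given for simple root vectors. -/
theorem mode_glRoot_succ_lie {r : ℕ} (hv : IsStandardModule (fundamentalWeight ℓ r) v)
    {p q : Fin ℓ} (hpq : q.val = p.val + 1) (hq : q.val + 1 ≤ r) :
    ⁅mode 0 (glRoot q p), v⁆ = 0 := by
  have hne : p ≠ q := by rintro rfl; omega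
  have key (x y : G ℓ) : ⁅mode 0 x, mode 0 y⁆ = mode 0 ⁅x, y⁆ := by simp [mode_lie_mode]
  have hint := hv.integrable (mode 0 (glRoot q p)) (.inl ⟨p + 1, by omega, by omega, glRoot q p,
    .inr ?_, rfl⟩) v
  · obtain ⟨N, hN⟩ := hint
    refine lie_eq_zero_of_sl2 (e := mode 0 (glRoot p q)) rfl ?_ ?_ ?_ ?_ hN
    · rw [key, key, glRoot_lie_glRoot, cartan_lie_glRoot, map_smul]
      simp [hne, hne.symm]; norm_num
    · rw [key, key, glRoot_lie_glRoot, cartan_lie_glRoot, map_smul, ← neg_smul]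
      simp [hne, hne.symm]; norm_num
    · exact hv.mode_zero_lie ⟨p + 1, q + 1, by omega, by omega, .inr ⟨by omega, rfl⟩⟩
        (glRoot_mem_rootSpace p q)
    · have h := hv.cartan_add_central_lie (Pi.single p 1 - Pi.single q 1) 0
      rw [zero_smul, add_zero, zero_add] at h
      rw [key, glRoot_lie_glRoot, h]
      have : ∑ m : Fin ℓ, (if m.val + 1 ≤ r then
          (Pi.single p 1 - Pi.single q 1 : Fin ℓ → ℂ) m else 0) = 0 := by
        have h1 := (sum_ite_single r p).trans (if_pos (by omega))
        have h2 := (sum_ite_single r q).trans (if_pos hq)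
        refine Eq.trans ?_ ((congrArg₂ (· - ·) h1 h2).trans (sub_self 1))
        simp only [← Finset.sum_sub_distrib]
        refine Finset.sum_congr rfl fun m _ => ?_
        split_ifs <;> simp
      rw [this, zero_smul]
  · have h := glRoot_mem_rootSpace q p
    rw [hpq] at h
    rwa [simpleRoot, if_pos (by omega), neg_sub]

/-- The case of `α₀ = δ - θ`: its coroot `c - θ^∨` takes the value `1 - 1 = 0` on `Λ_r` once `r ≥
1`. -/
theorem mode_posRoot_zero_lie {r : ℕ} (hv : IsStandardModule (fundamentalWeight ℓ r) v)
    {p : Fin ℓ} (hp : p.val = 0) (hr : 1 ≤ r) : ⁅mode (-1) (posRoot p p), v⁆ = 0 := by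
  have hmem := posRoot_mem_rootSpace p p
  rw [hp, ← two_smul ℕ] at hmem
  obtain ⟨N, hN⟩ := hv.integrable (mode (-1) (posRoot p p)) (.inr (.inr ⟨_, hmem, rfl⟩)) v
  have hc (n : ℤ) (a : Fin ℓ → ℂ) (s : ℂ) (x : G ℓ) :
      ⁅mode 0 (cartan ℓ a) + s • central ℓ, mode n x⁆ = mode n ⁅cartan ℓ a, x⁆ := by
    simp [mode_lie_mode, central_lie]
  -- The factor `1/4` offsets the entries `2` in both root vectors, making the bracket exactly the
  -- coroot of `α₀`.
  have hb : ⁅(1 / 4 : ℂ) • mode 1 (negRoot p p), mode (-1) (posRoot p p)⁆ = (1 / 2 : ℂ) •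
      (mode 0 (cartan ℓ (-(Pi.single p 1 + Pi.single p 1))) + (2 : ℂ) • central ℓ) := by
    rw [smul_lie, mode_negRoot_lie_posRoot, smul_smul]
    norm_num
  refine lie_eq_zero_of_sl2 hb ?_ ?_ ?_ ?_ hN
  · rw [smul_lie, lie_smul, hc, cartan_lie_negRoot, map_smul, smul_smul, smul_smul, smul_smul]
    congr 1
    simp; norm_num
  · rw [smul_lie, hc, cartan_lie_posRoot, map_smul, smul_smul, ← neg_smul]
    congr 1
    simp; norm_num
  · rw [smul_lie, hv.mode_pos_lie one_pos, smul_zero]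
  · rw [← hb, smul_lie, smul_lie]
    have h := mode_negRoot_lie_posRoot_lie hv p p
    rw [leibniz_lie, hv.mode_pos_lie one_pos, lie_zero, add_zero] at h
    rw [h, if_pos rfl, if_pos (by omega)]
    norm_num

/-- Two operators that kill `v` have a commutator that kills `v`. No central term arises, as the
degrees `0` and `-1` do not cancel. -/
theorem mode_posRoot_succ_lie {r : ℕ} (hv : IsStandardModule (fundamentalWeight ℓ r) v)
    {p q s : Fin ℓ} (hpq : q.val = p.val + 1) (hq : q.val + 1 ≤ r)
    (h : ⁅mode (-1) (posRoot p s), v⁆ = 0) : ⁅mode (-1) (posRoot q s), v⁆ = 0 := by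
  have h1 : ⁅⁅mode 0 (glRoot q p), mode (-1) (posRoot p s)⁆, v⁆ = 0 := by
    rw [lie_lie, h, mode_glRoot_succ_lie hv hpq hq, lie_zero, lie_zero, sub_zero]
  rw [mode_lie_mode, glRoot_lie_posRoot] at h1
  simp only [zero_add, Int.reduceNeg, neg_eq_zero, one_ne_zero, if_false, zero_smul, add_zero,
    map_smul, smul_lie] at h1
  refine (smul_eq_zero.1 h1).resolve_left ?_
  split_ifs <;> norm_num

theorem mode_posRoot_lie_of_base {r : ℕ} (hv : IsStandardModule (fundamentalWeight ℓ r) v)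
    {p s : Fin ℓ} (hp : p.val = 0) (h : ⁅mode (-1) (posRoot p s), v⁆ = 0) {q : Fin ℓ}
    (hq : q.val + 1 ≤ r) : ⁅mode (-1) (posRoot q s), v⁆ = 0 := by
  obtain ⟨n, hn⟩ := q
  induction n with
  | zero => rwa [show (⟨0, hn⟩ : Fin ℓ) = p from Fin.ext hp.symm]
  | succ n ih =>
    exact mode_posRoot_succ_lie hv (p := ⟨n, by omega⟩) rfl hq
      (ih (by omega) (by simp only at hq ⊢; omega))

theorem mode_posRoot_lie_eq_zero {r : ℕ} (hv : IsStandardModule (fundamentalWeight ℓ r) v)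
    {p q : Fin ℓ} (hp : p.val + 1 ≤ r) (hq : q.val + 1 ≤ r) :
    ⁅mode (-1) (posRoot p q), v⁆ = 0 := by
  have h0 : 0 < ℓ := by omega
  have h := mode_posRoot_zero_lie hv (p := ⟨0, h0⟩) rfl (by omega)
  have h' := mode_posRoot_lie_of_base hv rfl h hq
  -- Symmetry in the two indices lets the same induction raise the other one.
  rw [posRoot_comm] at h'
  exact mode_posRoot_lie_of_base hv rfl h' hp

end Module

end AffineC

open AffineC in
theorem mainTheorem8 (ℓ r : ℕ) (hr : r ≤ ℓ)
    (V : Type*) [AddCommGroup V] [Module ℂ V]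
    [LieRingModule (Affine ℓ) V] [LieModule ℂ (Affine ℓ) V]
    (v : V) (hv : IsStandardModule (fundamentalWeight ℓ r) v)
    (i j : ℕ) (hi : 1 ≤ i) (hij : i ≤ j) (hj : j ≤ ℓ)
    (x : G ℓ) (hx : x ∈ rootSpace (eps ℓ i + eps ℓ j)) (hx0 : x ≠ 0) :
    (j ≤ r → ⁅mode (-1) x, v⁆ = 0) ∧ (r < j → ⁅mode (-1) x, v⁆ ≠ 0) := by
  obtain ⟨p, rfl⟩ : ∃ p : Fin ℓ, i = p.val + 1 := ⟨⟨i - 1, by omega⟩, by simp only; omega⟩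
  obtain ⟨q, rfl⟩ : ∃ q : Fin ℓ, j = q.val + 1 := ⟨⟨j - 1, by omega⟩, by simp only; omega⟩
  obtain ⟨s, rfl⟩ := exists_eq_smul_posRoot hx
  rw [map_smul, smul_lie]
  refine ⟨fun h => ?_, fun h => ?_⟩
  · rw [mode_posRoot_lie_eq_zero hv (hij.trans h) h, smul_zero]
  · refine smul_ne_zero ?_ (mode_posRoot_lie_ne_zero hv h)
    -- The scalar is nonzero because `x` is.
    rintro rfl
    exact hx0 (zero_smul _ _)
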